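/- Let $N\ge 3$ be an integer, let $p_S:=\frac{N+2}{N-2}$, and let $p>p_S$. For $\lambda>0$ consider the Neumann problem for positive radial functions in the unit ball of $\mathbb{R}^N$, \[ \begin{cases} U''+\frac{N-1}{r}U'+\lambda\left(-U+U^p\right)=0, & 0<r<1,\\ U'(1)=0, & \\ U>0, & 0\le r\le 1, \end{cases} \] where a solution is a (regular) function $U\in C^2(0,1)\cap C^0[0,1]$ that satisfies these three conditions, $U'(1)$ being the one-sided derivative. There exists $\underline{\lambda}>0$ such that, if $0<\lambda<\underline{\lambda}$, then the problem has no nonconstant solution. Moreover, there exists $\bar{\lambda}>0$ such that, if $\lambda>\bar{\lambda}$, then the problem has no radially decreasing solution, i.e., no solution $U$ that is strictly decreasing on $[0,1]$. -/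

import Mathlib

/-- The critical Sobolev exponent `p_S = (N + 2) / (N - 2)`, for dimensions `N ≥ 3`. -/
noncomputable def sobolevExponent (N : ℕ) : ℝ := ((N : ℝ) + 2) / ((N : ℝ) - 2)

/-- `U` is a (regular) solution of the radial Neumann problem in the unit ball of `ℝ^N`:
`U'' + ((N - 1) / r) U' + lam (-U + U ^ p) = 0` for `0 < r < 1`, `U'(1) = 0`,
`U > 0` on `[0, 1]`. Only the values of `U` on `[0, 1]` matter. -/
structure IsNeumannSolution (N : ℕ) (p lam : ℝ) (U : ℝ → ℝ) : Prop where
  continuousOn : ContinuousOn U (Set.Icc 0 1)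
  contDiffOn : ContDiffOn ℝ 2 U (Set.Ioo 0 1)
  equation : ∀ r ∈ Set.Ioo (0 : ℝ) 1,
    deriv (deriv U) r + ((N : ℝ) - 1) / r * deriv U r + lam * (-U r + U r ^ p) = 0
  neumann : HasDerivWithinAt U 0 (Set.Icc 0 1) 1
  pos : ∀ r ∈ Set.Icc (0 : ℝ) 1, 0 < U r

open Set Filter Topology MeasureTheory

/-! The regular radial problem is first rewritten for a pair `(U, D)` with `D` continuous on `[0,
1]` and zero at both ends (`exists_isRadialProfile`). Three monotone quantities then carry the
argument: the energy `D ^ 2 / 2 + lam F(U)` with `F(u) = u ^ (p + 1) / (p + 1) - u ^ 2 / 2`, the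
Pohozaev functional, and the Emden–Fowler energy of `r ^ θ U` in `log r`, `θ = 2 / (p - 1)`. The
last two decrease because `p` is supercritical.

Small `lam`: solutions are bounded independently of `lam` (`exists_uniform_bound`). Pohozaev gives
`F(U 1) ≤ 0`, so `U 1` is bounded, and the energy shows that a large value of `U` cannot exceed `U
0`. If `U 0` is large, `U` stays above `U 0 / 2` on a core of radius about `(lam U(0) ^ (p - 1)) ^
(-1/2)`. Either the core covers the ball, making `U 1` too large, or the scaled energy at its edge
is below a negative multiple of `lam ^ (-θ)`; it stays so up to `r = 1`, where it is bounded below.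
Given the bound, the nonlinearity is Lipschitz, and since `U` takes the value `1`, a contraction
estimate forces `U = 1` (`eq_one_of_le`).

Large `lam`: a decreasing `U` is still above `1` at `1/8`, or lies between some `δ` and `1` on
`[1/8, 1/4]`, or is below `δ` from `1/4` on. In the first two cases a strong reaction term makes `U`
fall further than its range allows (`bound_of_one_lt`, `bound_of_le_one`). In the third, `U` in the
interior is a large multiple of `U 1`, so the Pohozaev functional loses more than its boundary value
permits (`bound_of_small`). -/

/-- `U` together with its derivative `D`, extended continuously to `[0, 1]`, solves the radial
Neumann problem. -/
structure IsRadialProfile (N : ℕ) (p lam : ℝ) (U D : ℝ → ℝ) : Prop where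
  contU : ContinuousOn U (Icc 0 1)
  contD : ContinuousOn D (Icc 0 1)
  zero : D 0 = 0
  one : D 1 = 0
  hasDerivAt : ∀ r ∈ Ioo (0 : ℝ) 1, HasDerivAt U (D r) r
  hasDerivAt' : ∀ r ∈ Ioo (0 : ℝ) 1,
    HasDerivAt D (-(((N : ℝ) - 1) / r * D r) - lam * (U r ^ p - U r)) r
  pos : ∀ r ∈ Icc (0 : ℝ) 1, 0 < U r

/-! ### Comparison of increments and logarithmic divergence. -/

/-- Comparison of increments of two functions through their derivatives. -/
lemma sub_le_sub_of_hasDerivAt_le {f g f' g' : ℝ → ℝ} {a b : ℝ} (hab : a ≤ b)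
    (hf : ContinuousOn f (Icc a b)) (hg : ContinuousOn g (Icc a b))
    (hf' : ∀ x ∈ Ioo a b, HasDerivAt f (f' x) x) (hg' : ∀ x ∈ Ioo a b, HasDerivAt g (g' x) x)
    (h : ∀ x ∈ Ioo a b, f' x ≤ g' x) : f b - f a ≤ g b - g a := by
  have hm : MonotoneOn (fun x => g x - f x) (Icc a b) := by
    refine monotoneOn_of_deriv_nonneg (convex_Icc a b) (hg.sub hf) ?_ ?_
    · rw [interior_Icc]
      exact fun x hx => ((hg' x hx).fun_sub (hf' x hx)).differentiableAt.differentiableWithinAt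
    · rw [interior_Icc]
      intro x hx
      rw [((hg' x hx).fun_sub (hf' x hx)).deriv]
      linarith [h x hx]
  have := hm (left_mem_Icc.2 hab) (right_mem_Icc.2 hab) hab
  simp only at this
  linarith

lemma sub_le_of_hasDerivAt_le {f f' : ℝ → ℝ} {a b C : ℝ} (hab : a ≤ b)
    (hf : ContinuousOn f (Icc a b)) (hf' : ∀ x ∈ Ioo a b, HasDerivAt f (f' x) x)
    (h : ∀ x ∈ Ioo a b, f' x ≤ C) : f b - f a ≤ C * (b - a) := by
  have := sub_le_sub_of_hasDerivAt_le (g := fun x => C * x) (g' := fun _ => C) hab hf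
    (by fun_prop) hf' (fun x _ => by simpa using (hasDerivAt_id x).const_mul C) h
  linarith

lemma le_sub_of_le_hasDerivAt {f f' : ℝ → ℝ} {a b C : ℝ} (hab : a ≤ b)
    (hf : ContinuousOn f (Icc a b)) (hf' : ∀ x ∈ Ioo a b, HasDerivAt f (f' x) x)
    (h : ∀ x ∈ Ioo a b, C ≤ f' x) : C * (b - a) ≤ f b - f a := by
  have := sub_le_sub_of_hasDerivAt_le (f := fun x => C * x) (f' := fun _ => C) hab
    (by fun_prop) hf (fun x _ => by simpa using (hasDerivAt_id x).const_mul C) hf' h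
  linarith

/-- A function whose derivative is at least `c / x` near `0+`, with `c > 0`, is not bounded
below. -/
lemma not_bddBelow_of_inv_le_deriv {f f' : ℝ → ℝ} {c ε m : ℝ} (hc : 0 < c) (hε : 0 < ε)
    (hf' : ∀ x ∈ Ioc 0 ε, HasDerivAt f (f' x) x) (h : ∀ x ∈ Ioc 0 ε, c / x ≤ f' x)
    (hm : ∀ x ∈ Ioc 0 ε, m ≤ f x) : False := by
  have key : ∀ x ∈ Ioc 0 ε, c * (Real.log ε - Real.log x) ≤ f ε - m := by
    intro x hx
    have h1 := sub_le_sub_of_hasDerivAt_le (f := fun x => c * Real.log x)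
      (f' := fun x => c * x⁻¹) (g := f) (g' := f') (a := x) (b := ε) hx.2
      (ContinuousOn.mul continuousOn_const (Real.continuousOn_log.mono
        (fun y hy => (hx.1.trans_le hy.1).ne')))
      (fun y hy => (hf' y ⟨hx.1.trans_le hy.1, hy.2⟩).continuousAt.continuousWithinAt)
      (fun y hy => (Real.hasDerivAt_log (hx.1.trans hy.1).ne').const_mul c)
      (fun y hy => hf' y ⟨hx.1.trans hy.1, hy.2.le⟩)
      (fun y hy => h y ⟨hx.1.trans hy.1, hy.2.le⟩)
    have := hm x hx
    linarith
  have ht := Real.tendsto_log_nhdsGT_zero.eventually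
    (eventually_lt_atBot (Real.log ε - (f ε - m) / c))
  obtain ⟨x, hx1, hx2⟩ := (ht.and (Ioc_mem_nhdsGT hε)).exists
  have := key x hx2
  have h3 : (f ε - m) / c < Real.log ε - Real.log x := by linarith
  rw [div_lt_iff₀ hc] at h3
  linarith

/-! ### Regularity of solutions at the origin and at the boundary. -/

namespace IsNeumannSolution

variable {N : ℕ} {p lam : ℝ} {U : ℝ → ℝ}

lemma hasDerivAt_deriv (h : IsNeumannSolution N p lam U) {r : ℝ} (hr : r ∈ Ioo (0 : ℝ) 1) :
    HasDerivAt U (deriv U r) r ∧ HasDerivAt (deriv U) (deriv (deriv U) r) r := by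
  have h2 := h.contDiffOn
  have h1 : ContDiffOn ℝ 1 (deriv U) (Ioo 0 1) := by
    have : ContDiffOn ℝ (1 + 1) U (Ioo 0 1) := by norm_num; exact h2
    exact ((contDiffOn_succ_iff_deriv_of_isOpen isOpen_Ioo).1 this).2.2
  exact ⟨((h2.differentiableOn (by norm_num)).differentiableAt (isOpen_Ioo.mem_nhds hr)).hasDerivAt,
    ((h1.differentiableOn (by norm_num)).differentiableAt (isOpen_Ioo.mem_nhds hr)).hasDerivAt⟩

/-- The flux `r ^ (N - 1) U'` is the primitive of `-lam r ^ (N - 1) (U ^ p - U)` up to a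
constant. -/
lemma exists_flux (hp : 1 < p) (hN : 3 ≤ N) (h : IsNeumannSolution N p lam U) :
    ∃ (Q : ℝ → ℝ) (c : ℝ), ContinuousOn Q (Icc 0 1) ∧ Q 0 = 0 ∧
      (∀ r ∈ Ioo (0 : ℝ) 1, HasDerivAt Q (-(lam * (r ^ (N - 1) * (U r ^ p - U r)))) r) ∧
      ∀ r ∈ Ioo (0 : ℝ) 1, deriv U r = (c + Q r) / r ^ (N - 1) := by
  set F : ℝ → ℝ := fun r => -(lam * (r ^ (N - 1) * (U r ^ p - U r))) with hF
  have hFc : ContinuousOn F (Icc 0 1) := by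
    have := h.continuousOn
    have h2 : ContinuousOn (fun r => U r ^ p) (Icc 0 1) :=
      this.rpow_const (fun x _ => Or.inr (by linarith))
    fun_prop
  have hFi : IntegrableOn F (Icc 0 1) := hFc.integrableOn_Icc
  have hQd : ∀ r ∈ Ioo (0 : ℝ) 1, HasDerivAt (fun r => ∫ s in (0 : ℝ)..r, F s) (F r) r := by
    intro r hr
    refine intervalIntegral.integral_hasDerivAt_right ?_ ?_ ?_
    · rw [intervalIntegrable_iff_integrableOn_Icc_of_le hr.1.le]
      exact hFi.mono_set (Icc_subset_Icc_right hr.2.le)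
    · exact (hFc.mono Ioo_subset_Icc_self).stronglyMeasurableAtFilter isOpen_Ioo r hr
    · exact hFc.continuousAt (Icc_mem_nhds hr.1 hr.2)
  have hqd : ∀ r ∈ Ioo (0 : ℝ) 1, HasDerivAt (fun r => r ^ (N - 1) * deriv U r) (F r) r := by
    intro r hr
    have h1 := ((hasDerivAt_pow (N - 1) r).mul (h.hasDerivAt_deriv hr).2)
    refine h1.congr_deriv ?_
    have he := h.equation r hr
    have hr0 : r ≠ 0 := hr.1.ne'
    obtain ⟨n, rfl⟩ : ∃ n, N = n + 2 := ⟨N - 2, by omega⟩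
    have e : deriv (deriv U) r
      = -((((n + 2 : ℕ) : ℝ) - 1) / r * deriv U r) - lam * (-U r + U r ^ p) := by linarith
    rw [e]
    simp only [hF, Nat.add_sub_cancel, show n + 2 - 1 = n + 1 by omega]
    push_cast
    field_simp
    ring
  -- The base point `1 / 2` is arbitrary: flux minus primitive is constant on the open interval, and
  -- `c` is its value there.
  refine ⟨fun r => ∫ s in (0 : ℝ)..r, F s, (1 / 2 : ℝ) ^ (N - 1) * deriv U (1 / 2)
    - ∫ s in (0 : ℝ)..(1 / 2), F s, ?_, by simp, hQd, ?_⟩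
  · have := intervalIntegral.continuousOn_primitive_interval (μ := volume) (f := F)
      (a := 0) (b := 1) (by rwa [uIcc_of_le zero_le_one])
    rwa [uIcc_of_le zero_le_one] at this
  · intro r hr
    have hconst := isOpen_Ioo.is_const_of_deriv_eq_zero
      (f := fun r => r ^ (N - 1) * deriv U r - ∫ s in (0 : ℝ)..r, F s)
      (s := Ioo (0 : ℝ) 1) isPreconnected_Ioo
      (fun x hx => ((hqd x hx).fun_sub (hQd x hx)).differentiableAt.differentiableWithinAt)
      (fun x hx => by simpa using ((hqd x hx).fun_sub (hQd x hx)).deriv)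
      hr (show (1 / 2 : ℝ) ∈ Ioo (0 : ℝ) 1 by norm_num)
    rw [eq_div_iff (pow_ne_zero _ hr.1.ne')]
    linarith

/-- The derivative of a solution extends continuously to `[0, 1]`, vanishing at both ends. -/
lemma exists_isRadialProfile (hp : 1 < p) (hN : 3 ≤ N) (h : IsNeumannSolution N p lam U) :
    ∃ D, IsRadialProfile N p lam U D := by
  obtain ⟨Q, c, hQc, hQ0, hQd, hU⟩ := h.exists_flux hp hN
  have hUc := h.continuousOn
  have hQt : Tendsto Q (𝓝[>] 0) (𝓝 0) := by
    have := (hQc 0 (by norm_num)).tendsto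
    rw [hQ0] at this
    exact this.mono_left (nhdsWithin_le_of_mem (Icc_mem_nhdsGT zero_lt_one))
  have hpow : ∀ x ∈ Ioo (0 : ℝ) 1, x ^ (N - 1) ≤ x := fun x hx =>
    pow_le_of_le_one hx.1.le hx.2.le (by omega)
  obtain ⟨M, hM⟩ := (isCompact_Icc (a := (0 : ℝ)) (b := 1)).bddAbove_image hUc
  have hM' : ∀ x ∈ Icc (0 : ℝ) 1, U x ≤ M := fun x hx => hM (mem_image_of_mem U hx)
  -- If `c ≠ 0`, then `|U'| ≥ |c| / (2 r)` near `0`, since `r ^ (N - 1) ≤ r`, so `U` diverges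
  -- logarithmically. This contradicts the bound `M` if `c < 0` and positivity if `c > 0`.
  have hc : c = 0 := by
    rcases lt_trichotomy c 0 with hc | hc | hc
    · exfalso
      obtain ⟨ε, hε, he⟩ := (nhdsGT_basis (0 : ℝ)).eventually_iff.1
        (hQt.eventually (Iio_mem_nhds (show 0 < -c / 2 by linarith)))
      set ε' := min (ε / 2) (1 / 2)
      have hε' : 0 < ε' := by positivity
      have h1 : ε' ≤ ε / 2 := min_le_left _ _
      have h2 : ε' ≤ 1 / 2 := min_le_right _ _
      refine not_bddBelow_of_inv_le_deriv (f := fun x => - U x) (f' := fun x => -deriv U x)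
        (c := -c / 2) (m := -M) (by linarith) hε' ?_ ?_ ?_
      · exact fun x hx => (h.hasDerivAt_deriv ⟨hx.1, by linarith [hx.2]⟩).1.neg
      · intro x hx
        have hx' : x ∈ Ioo (0 : ℝ) 1 := ⟨hx.1, by linarith [hx.2]⟩
        have := he (show x ∈ Ioo 0 ε from ⟨hx.1, by linarith [hx.2]⟩)
        rw [hU x hx', ← neg_div]
        exact div_le_div₀ (by linarith) (by linarith) (pow_pos hx.1 _) (hpow x hx')
      · exact fun x hx => neg_le_neg (hM' x ⟨hx.1.le, by linarith [hx.2]⟩)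
    · exact hc
    · exfalso
      obtain ⟨ε, hε, he⟩ := (nhdsGT_basis (0 : ℝ)).eventually_iff.1
        (hQt.eventually (Ioi_mem_nhds (show -(c / 2) < 0 by linarith)))
      set ε' := min (ε / 2) (1 / 2)
      have hε' : 0 < ε' := by positivity
      have h1 : ε' ≤ ε / 2 := min_le_left _ _
      have h2 : ε' ≤ 1 / 2 := min_le_right _ _
      refine not_bddBelow_of_inv_le_deriv (f := U) (f' := deriv U)
        (c := c / 2) (m := 0) (by linarith) hε' ?_ ?_ ?_
      · exact fun x hx => (h.hasDerivAt_deriv ⟨hx.1, by linarith [hx.2]⟩).1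
      · intro x hx
        have hx' : x ∈ Ioo (0 : ℝ) 1 := ⟨hx.1, by linarith [hx.2]⟩
        have := he (show x ∈ Ioo 0 ε from ⟨hx.1, by linarith [hx.2]⟩)
        rw [hU x hx']
        exact div_le_div₀ (by linarith) (by linarith) (pow_pos hx.1 _) (hpow x hx')
      · exact fun x hx => (h.pos x ⟨hx.1.le, by linarith [hx.2]⟩).le
  subst hc
  simp only [zero_add] at hU
  obtain ⟨K, hK⟩ := (isCompact_Icc (a := (0 : ℝ)) (b := 1)).exists_bound_of_continuousOn
    (f := fun r => lam * (U r ^ p - U r)) (by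
      have h2 : ContinuousOn (fun r => U r ^ p) (Icc 0 1) :=
        hUc.rpow_const (fun x _ => Or.inr (by linarith))
      fun_prop)
  have hK0 : 0 ≤ K := (norm_nonneg _).trans (hK 0 (by norm_num))
  -- The extra factor `r` beyond `r ^ (N - 1)` makes the quotient `O(r)`, hence continuous at `0`
  -- with value `0`.
  have hQb : ∀ r ∈ Icc (0 : ℝ) 1, |Q r| ≤ K * r ^ (N - 1) * r := by
    intro r hr
    have hd : ∀ x ∈ Ioo 0 r, |-(lam * (x ^ (N - 1) * (U x ^ p - U x)))| ≤ K * r ^ (N - 1) := by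
      intro x hx
      have hx1 : x ∈ Icc (0 : ℝ) 1 := ⟨hx.1.le, hx.2.le.trans hr.2⟩
      have e : -(lam * (x ^ (N - 1) * (U x ^ p - U x)))
        = -(lam * (U x ^ p - U x)) * x ^ (N - 1) := by ring
      rw [e, abs_mul, abs_neg, abs_of_nonneg (pow_nonneg hx.1.le _)]
      exact mul_le_mul (hK x hx1) (pow_le_pow_left₀ hx.1.le hx.2.le _)
        (pow_nonneg hx.1.le _) hK0
    have hc' := hQc.mono (Icc_subset_Icc_right hr.2)
    have hd' : ∀ x ∈ Ioo 0 r, HasDerivAt Q (-(lam * (x ^ (N - 1) * (U x ^ p - U x)))) x :=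
      fun x hx => hQd x ⟨hx.1, hx.2.trans_le hr.2⟩
    have h1 := sub_le_of_hasDerivAt_le hr.1 hc' hd' (fun x hx => (abs_le.1 (hd x hx)).2)
    have h2 := le_sub_of_le_hasDerivAt hr.1 hc' hd' (fun x hx => (abs_le.1 (hd x hx)).1)
    rw [hQ0] at h1 h2
    rw [abs_le]
    constructor <;> linarith
  have hDb : ∀ r ∈ Icc (0 : ℝ) 1, |Q r / r ^ (N - 1)| ≤ K * r := by
    intro r hr
    rcases hr.1.eq_or_lt with h0 | h0
    · subst h0; simp [hQ0]
    · have hp : 0 < r ^ (N - 1) := pow_pos h0 _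
      rw [abs_div, abs_of_pos hp, div_le_iff₀ hp]
      calc _ ≤ _ := hQb r hr
        _ = _ := by ring
  have hDc : ContinuousOn (fun r => Q r / r ^ (N - 1)) (Icc 0 1) := by
    intro r hr
    rcases hr.1.eq_or_lt with h0 | h0
    · subst h0
      have : Tendsto (fun r : ℝ => K * r) (𝓝[Icc 0 1] 0) (𝓝 0) := by
        have : Continuous (fun r : ℝ => K * r) := by fun_prop
        simpa using (this.tendsto 0).mono_left nhdsWithin_le_nhds
      have h2 := squeeze_zero_norm' (f := fun r => Q r / r ^ (N - 1))
        (eventually_mem_nhdsWithin.mono (fun r hr => hDb r hr)) this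
      simpa [ContinuousWithinAt, hQ0] using h2
    · exact (hQc r hr).div (by fun_prop) (pow_ne_zero _ h0.ne')
  -- The limit of `U'` at `1` is also the one-sided derivative there, which the Neumann condition
  -- sets to `0`.
  have hD1 : Q 1 = 0 := by
    have ht : Tendsto (fun x => deriv U x) (𝓝[<] 1) (𝓝 (Q 1)) := by
      have h1 := (hDc 1 (by norm_num)).tendsto.mono_left
        (nhdsWithin_le_of_mem (Icc_mem_nhdsLT zero_lt_one))
      simp only [one_pow, div_one] at h1
      refine h1.congr' ?_
      filter_upwards [Ioo_mem_nhdsLT (zero_lt_one (α := ℝ))] with x hx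
      exact (hU x hx).symm
    have h1 := hasDerivWithinAt_Iic_of_tendsto_deriv (s := Ioo 0 1)
      (h.contDiffOn.differentiableOn (by norm_num))
      ((hUc 1 (by norm_num)).mono Ioo_subset_Icc_self) (Ioo_mem_nhdsLT zero_lt_one) ht
    exact ((uniqueDiffOn_Icc zero_lt_one).uniqueDiffWithinAt (by norm_num)).eq_deriv _
      (h1.mono Icc_subset_Iic_self) h.neumann
  have hev : ∀ r ∈ Ioo (0 : ℝ) 1, (fun r => Q r / r ^ (N - 1)) =ᶠ[𝓝 r] deriv U := by
    intro r hr
    filter_upwards [isOpen_Ioo.mem_nhds hr] with x hx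
    exact (hU x hx).symm
  refine ⟨fun r => Q r / r ^ (N - 1), hUc, hDc, by simp [hQ0], by simp [hD1], ?_, ?_, h.pos⟩
  · intro r hr
    have := (h.hasDerivAt_deriv hr).1
    rwa [hU r hr] at this
  · intro r hr
    have h1 := (h.hasDerivAt_deriv hr).2.congr_of_eventuallyEq (hev r hr)
    refine h1.congr_deriv ?_
    have he := h.equation r hr
    rw [hU r hr] at he
    linarith

end IsNeumannSolution

/-! ### Energy, Pohozaev and Emden–Fowler identities. -/

/-- The Pohozaev functional. -/
noncomputable def pohozaev (N : ℕ) (p lam : ℝ) (U D : ℝ → ℝ) (r : ℝ) : ℝ :=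
  r ^ N * (D r ^ 2 / 2 + lam * (U r ^ (p + 1) / (p + 1) - U r ^ 2 / 2))
    + ((N : ℝ) - 2) / 2 * (r ^ (N - 1) * (U r * D r))

/-- The energy of `r ^ θ U(r)` in the variable `log r`, where `θ = 2 / (p - 1)`. -/
noncomputable def scaledEnergy (N : ℕ) (p lam θ : ℝ) (U D : ℝ → ℝ) (r : ℝ) : ℝ :=
  r ^ (2 * θ) * ((θ * U r + r * D r) ^ 2 / 2 - θ * ((N : ℝ) - 2 - θ) * U r ^ 2 / 2
    + lam * r ^ 2 * U r ^ (p + 1) / (p + 1) - lam * r ^ 2 * U r ^ 2 / 2)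

namespace IsRadialProfile

variable {N : ℕ} {p lam : ℝ} {U D : ℝ → ℝ}

lemma hasDerivAt_rpow_add_one (hp : 1 < p) (h : IsRadialProfile N p lam U D) {r : ℝ}
    (hr : r ∈ Ioo (0 : ℝ) 1) :
    HasDerivAt (fun r => U r ^ (p + 1)) ((p + 1) * U r ^ p * D r) r := by
  refine ((h.hasDerivAt r hr).rpow_const (p := p + 1) (Or.inr (by linarith))).congr_deriv ?_
  rw [add_sub_cancel_right]
  ring

lemma continuousOn_rpow {q : ℝ} (hq : 0 ≤ q) (h : IsRadialProfile N p lam U D) :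
    ContinuousOn (fun r => U r ^ q) (Icc 0 1) :=
  h.contU.rpow_const (fun _ _ => Or.inr hq)

lemma rpow_add_one_eq (h : IsRadialProfile N p lam U D) {r : ℝ} (hr : r ∈ Icc (0 : ℝ) 1) :
    U r ^ (p + 1) = U r ^ p * U r := by
  rw [Real.rpow_add_one (h.pos r hr).ne']

/-- The energy `U' ^ 2 / 2 + lam F(U)` is nonincreasing. -/
lemma energy_le (hp : 1 < p) (hN : 3 ≤ N) (h : IsRadialProfile N p lam U D) {r : ℝ}
    (hr : r ∈ Icc (0 : ℝ) 1) :
    D r ^ 2 / 2 + lam * (U r ^ (p + 1) / (p + 1) - U r ^ 2 / 2)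
      ≤ lam * (U 0 ^ (p + 1) / (p + 1) - U 0 ^ 2 / 2) := by
  have hN' : (3 : ℝ) ≤ N := by exact_mod_cast hN
  have hp1 : p + 1 ≠ 0 := by linarith
  have key := sub_le_of_hasDerivAt_le (a := 0) (b := r) (C := 0)
    (f := fun r => D r ^ 2 / 2 + lam * (U r ^ (p + 1) / (p + 1) - U r ^ 2 / 2))
    (f' := fun r => -(((N : ℝ) - 1) / r * D r ^ 2)) hr.1 ?_ ?_ ?_
  · simp only [h.zero] at key
    linarith
  · have h1 := h.contU
    have h2 := h.contD
    have h3 := h.continuousOn_rpow (q := p + 1) (by linarith)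
    exact ContinuousOn.mono (by fun_prop) (Icc_subset_Icc_right hr.2)
  · intro x hx
    have hx' : x ∈ Ioo (0 : ℝ) 1 := ⟨hx.1, hx.2.trans_le hr.2⟩
    have h1 := (((h.hasDerivAt' x hx').fun_pow 2).div_const 2).fun_add
      ((((h.hasDerivAt_rpow_add_one hp hx').div_const (p + 1)).fun_sub
        (((h.hasDerivAt x hx').fun_pow 2).div_const 2)).const_mul lam)
    refine h1.congr_deriv ?_
    have hx0 := hx.1.ne'
    field_simp
    ring
  · intro x hx
    have : 0 ≤ ((N : ℝ) - 1) / x * D x ^ 2 :=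
      mul_nonneg (div_nonneg (by linarith) hx.1.le) (sq_nonneg _)
    linarith

/-- The equation in divergence form, for the flux `r ^ (N - 1) D`. -/
lemma hasDerivAt_flux (hN : 3 ≤ N) (h : IsRadialProfile N p lam U D) {r : ℝ}
    (hr : r ∈ Ioo (0 : ℝ) 1) :
    HasDerivAt (fun r => r ^ (N - 1) * D r) (-(lam * r ^ (N - 1) * (U r ^ p - U r))) r := by
  refine ((hasDerivAt_pow (N - 1) r).fun_mul (h.hasDerivAt' r hr)).congr_deriv ?_
  have hr0 : r ≠ 0 := hr.1.ne'
  obtain ⟨n, rfl⟩ : ∃ n, N = n + 2 := ⟨N - 2, by omega⟩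
  simp only [Nat.add_sub_cancel, show n + 2 - 1 = n + 1 by omega]
  push_cast
  field_simp
  ring

lemma continuousOn_flux (h : IsRadialProfile N p lam U D) :
    ContinuousOn (fun r => r ^ (N - 1) * D r) (Icc 0 1) := by
  have := h.contD
  fun_prop

lemma continuousOn_pohozaev (hp : 1 < p) (h : IsRadialProfile N p lam U D) :
    ContinuousOn (pohozaev N p lam U D) (Icc 0 1) := by
  have h1 := h.contU
  have h2 := h.contD
  have h3 := h.continuousOn_rpow (q := p + 1) (by linarith)
  unfold pohozaev
  fun_prop

/-- The weight `(N - 2) / 2` is the one for which the `D ^ 2` terms cancel. The remaining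
coefficient of `U ^ (p + 1)` is nonnegative exactly for critical or supercritical `p`. -/
lemma hasDerivAt_pohozaev (hp : 1 < p) (hN : 3 ≤ N) (h : IsRadialProfile N p lam U D) {r : ℝ}
    (hr : r ∈ Ioo (0 : ℝ) 1) :
    HasDerivAt (pohozaev N p lam U D)
      (-(lam * r ^ (N - 1) * ((((N : ℝ) - 2) / 2 - N / (p + 1)) * U r ^ (p + 1) + U r ^ 2))) r := by
  have h1 := (((h.hasDerivAt' r hr).fun_pow 2).div_const 2).fun_add
      ((((h.hasDerivAt_rpow_add_one hp hr).div_const (p + 1)).fun_sub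
        (((h.hasDerivAt r hr).fun_pow 2).div_const 2)).const_mul lam)
  have h2 := ((hasDerivAt_pow N r).fun_mul h1).fun_add
    (((hasDerivAt_pow (N - 1) r).fun_mul
      ((h.hasDerivAt r hr).fun_mul (h.hasDerivAt' r hr))).const_mul (((N : ℝ) - 2) / 2))
  refine h2.congr_deriv ?_
  rw [h.rpow_add_one_eq (Ioo_subset_Icc_self hr)]
  have hr0 : r ≠ 0 := hr.1.ne'
  have hp1 : p + 1 ≠ 0 := by linarith
  obtain ⟨n, rfl⟩ : ∃ n, N = n + 2 := ⟨N - 2, by omega⟩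
  simp only [Nat.add_sub_cancel, show n + 2 - 1 = n + 1 by omega]
  push_cast
  field_simp
  ring

lemma pohozaev_deriv_le (hlam : 0 < lam)
    (ha : 0 ≤ ((N : ℝ) - 2) / 2 - N / (p + 1)) (h : IsRadialProfile N p lam U D) {r : ℝ}
    (hr : r ∈ Ioo (0 : ℝ) 1) :
    -(lam * r ^ (N - 1) * ((((N : ℝ) - 2) / 2 - N / (p + 1)) * U r ^ (p + 1) + U r ^ 2))
      ≤ -(lam * r ^ (N - 1) * U r ^ 2) := by
  have hU := h.pos r (Ioo_subset_Icc_self hr)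
  have h1 : 0 ≤ (((N : ℝ) - 2) / 2 - N / (p + 1)) * U r ^ (p + 1) := by positivity
  have h2 : 0 ≤ lam * r ^ (N - 1) := mul_nonneg hlam.le (pow_nonneg hr.1.le _)
  nlinarith [mul_nonneg h2 h1]

lemma pohozaev_antitone (hp : 1 < p) (hN : 3 ≤ N) (hlam : 0 < lam)
    (ha : 0 ≤ ((N : ℝ) - 2) / 2 - N / (p + 1)) (h : IsRadialProfile N p lam U D) {r s : ℝ}
    (hr : 0 ≤ r) (hrs : r ≤ s) (hs : s ≤ 1) :
    pohozaev N p lam U D s ≤ pohozaev N p lam U D r := by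
  have := sub_le_of_hasDerivAt_le (C := 0) hrs
    ((h.continuousOn_pohozaev hp).mono (Icc_subset_Icc hr hs))
    (fun x hx => h.hasDerivAt_pohozaev hp hN ⟨hr.trans_lt hx.1, hx.2.trans_le hs⟩)
    (fun x hx => by
      have hx' : x ∈ Ioo (0 : ℝ) 1 := ⟨hr.trans_lt hx.1, hx.2.trans_le hs⟩
      have h1 := h.pohozaev_deriv_le hlam ha hx'
      have h2 : 0 ≤ lam * x ^ (N - 1) * U x ^ 2 :=
        mul_nonneg (mul_nonneg hlam.le (pow_nonneg hx'.1.le _)) (sq_nonneg _)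
      linarith)
  linarith

lemma pohozaev_zero (hN : 3 ≤ N) : pohozaev N p lam U D 0 = 0 := by
  simp [pohozaev, zero_pow (show N ≠ 0 by omega), zero_pow (show N - 1 ≠ 0 by omega)]

lemma pohozaev_one (h : IsRadialProfile N p lam U D) :
    pohozaev N p lam U D 1 = lam * (U 1 ^ (p + 1) / (p + 1) - U 1 ^ 2 / 2) := by
  simp [pohozaev, h.one]

/-- With `t = log r` and `w = r ^ θ U`, the choice of `θ` makes the equation `w'' + (N - 2 - 2θ) w'
- θ (N - 2 - θ) w + lam w ^ p - lam e ^ (2t) w = 0`. The friction coefficient is nonnegative by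
`hκ`, and the explicit dependence on `t` also lowers the energy. -/
lemma scaledEnergy_antitone {θ : ℝ} (hp : 1 < p) (hlam : 0 < lam)
    (hθ : θ * (p - 1) = 2) (hκ : 0 ≤ (N : ℝ) - 2 - 2 * θ)
    (h : IsRadialProfile N p lam U D) {r s : ℝ} (hr : 0 < r) (hrs : r ≤ s) (hs : s ≤ 1) :
    scaledEnergy N p lam θ U D s ≤ scaledEnergy N p lam θ U D r := by
  have hθ0 : 0 < θ := by
    by_contra hc
    nlinarith
  have key := sub_le_of_hasDerivAt_le (a := r) (b := s) (C := 0) (f := scaledEnergy N p lam θ U D)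
    (f' := fun r => -(r ^ (2 * θ - 1) * (((N : ℝ) - 2 - 2 * θ) * (θ * U r + r * D r) ^ 2
      + lam * r ^ 2 * U r ^ 2))) hrs ?_ ?_ ?_
  · linarith
  · have h1 := h.contU
    have h2 := h.contD
    have h3 := h.continuousOn_rpow (q := p + 1) (by linarith)
    have h4 : ContinuousOn (fun r : ℝ => r ^ (2 * θ)) (Icc 0 1) :=
      continuousOn_id.rpow_const (fun _ _ => Or.inr (by linarith))
    refine ContinuousOn.mono ?_ (Icc_subset_Icc hr.le hs)
    unfold scaledEnergy
    fun_prop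
  · intro x hx
    have hx0 : 0 < x := hr.trans hx.1
    have hx' : x ∈ Ioo (0 : ℝ) 1 := ⟨hx0, hx.2.trans_le hs⟩
    have hU := h.hasDerivAt x hx'
    have hD := h.hasDerivAt' x hx'
    have h1 := (((((hU.const_mul θ).fun_add ((hasDerivAt_id' x).fun_mul hD)).fun_pow 2).div_const
      2).fun_sub (((hU.fun_pow 2).const_mul (θ * ((N : ℝ) - 2 - θ))).div_const 2)).fun_add
      ((((hasDerivAt_pow 2 x).const_mul lam).fun_mul
        (h.hasDerivAt_rpow_add_one hp hx')).div_const (p + 1))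
    have h2 := (Real.hasDerivAt_rpow_const (p := 2 * θ) (Or.inl hx0.ne')).fun_mul (h1.fun_sub
      ((((hasDerivAt_pow 2 x).const_mul lam).fun_mul (hU.fun_pow 2)).div_const 2))
    refine h2.congr_deriv ?_
    have e : x ^ (2 * θ) = x ^ (2 * θ - 1) * x := by
      rw [← Real.rpow_add_one hx0.ne', sub_add_cancel]
    rw [h.rpow_add_one_eq (Ioo_subset_Icc_self hx'), e]
    generalize x ^ (2 * θ - 1) = X
    generalize U x ^ p = Y
    -- Eliminating `p` in favour of `θ` turns the identity into a rational one.
    have hp1 : p + 1 = (2 * θ + 2) / θ := by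
      field_simp
      linarith
    rw [hp1]
    have : 2 * θ + 2 ≠ 0 := by positivity
    field_simp
    ring
  · intro x hx
    have hx0 : 0 < x := hr.trans hx.1
    have : 0 ≤ x ^ (2 * θ - 1) * (((N : ℝ) - 2 - 2 * θ) * (θ * U x + x * D x) ^ 2
      + lam * x ^ 2 * U x ^ 2) := by positivity
    linarith

/-! ### Constancy of bounded solutions for small `lam`. -/

/-- A bound of the nonlinearity controls the derivative. -/
lemma abs_deriv_le {K : ℝ} (hN : 3 ≤ N) (hlam : 0 < lam) (h : IsRadialProfile N p lam U D)
    (hK : ∀ r ∈ Icc (0 : ℝ) 1, |U r ^ p - U r| ≤ K) {r : ℝ} (hr : r ∈ Icc (0 : ℝ) 1) :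
    |D r| ≤ lam * K * r := by
  rcases hr.1.eq_or_lt with h0 | h0
  · subst h0; simp [h.zero]
  have hK0 : 0 ≤ K := (abs_nonneg _).trans (hK r hr)
  have hd : ∀ x ∈ Ioo 0 r, |-(lam * x ^ (N - 1) * (U x ^ p - U x))| ≤ lam * r ^ (N - 1) * K := by
    intro x hx
    rw [abs_neg, abs_mul, abs_of_nonneg (mul_nonneg hlam.le (pow_nonneg hx.1.le _))]
    exact mul_le_mul (mul_le_mul_of_nonneg_left (pow_le_pow_left₀ hx.1.le hx.2.le _) hlam.le)
      (hK x ⟨hx.1.le, hx.2.le.trans hr.2⟩) (abs_nonneg _) (by positivity)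
  have hc := h.continuousOn_flux.mono (Icc_subset_Icc_right hr.2)
  have hd' : ∀ x ∈ Ioo 0 r, HasDerivAt (fun r => r ^ (N - 1) * D r)
      (-(lam * x ^ (N - 1) * (U x ^ p - U x))) x :=
    fun x hx => h.hasDerivAt_flux hN ⟨hx.1, hx.2.trans_le hr.2⟩
  have h1 := sub_le_of_hasDerivAt_le hr.1 hc hd' (fun x hx => (abs_le.1 (hd x hx)).2)
  have h2 := le_sub_of_le_hasDerivAt hr.1 hc hd' (fun x hx => (abs_le.1 (hd x hx)).1)
  simp only [h.zero, mul_zero, sub_zero] at h1 h2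
  have hp : 0 < r ^ (N - 1) := pow_pos h0 _
  rw [abs_le]
  constructor
  · refine le_of_mul_le_mul_left ?_ hp
    linarith
  · refine le_of_mul_le_mul_left ?_ hp
    linarith

/-- Every solution takes the value `1`. -/
lemma exists_eq_one (hp : 1 < p) (hN : 3 ≤ N) (hlam : 0 < lam)
    (h : IsRadialProfile N p lam U D) : ∃ c ∈ Ioo (0 : ℝ) 1, U c = 1 := by
  -- Rolle's theorem for the flux, which vanishes at both ends.
  obtain ⟨c, hc, he⟩ := exists_hasDerivAt_eq_zero zero_lt_one h.continuousOn_flux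
    (by simp [h.zero, h.one]) (fun x hx => h.hasDerivAt_flux hN hx)
  refine ⟨c, hc, ?_⟩
  have hU := h.pos c (Ioo_subset_Icc_self hc)
  have h1 : U c ^ p = U c := by
    have h2 : lam * c ^ (N - 1) ≠ 0 := (mul_pos hlam (pow_pos hc.1 _)).ne'
    rcases mul_eq_zero.1 (neg_eq_zero.1 he) with h3 | h3
    · exact absurd h3 h2
    · linarith
  have h2 : U c ^ (p - 1) = 1 := by
    rw [Real.rpow_sub_one hU.ne', h1, div_self hU.ne']
  exact (Real.rpow_left_inj hU.le zero_le_one (by linarith : p - 1 ≠ 0)).1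
    (by rw [h2, Real.one_rpow])

/-- Bounded solutions are constant for small `lam`. -/
lemma eq_one_of_le {M : ℝ} (hp : 1 < p) (hN : 3 ≤ N) (hlam : 0 < lam) (hM : 1 ≤ M)
    (h : IsRadialProfile N p lam U D) (hU : ∀ r ∈ Icc (0 : ℝ) 1, U r ≤ M)
    (hsmall : lam * (p * M ^ (p - 1) + 1) < 1) : ∀ r ∈ Icc (0 : ℝ) 1, U r = 1 := by
  set L := p * M ^ (p - 1) + 1 with hL
  have hL0 : 0 < L := by positivity
  have hlip : ∀ x ∈ Ioc 0 M, |x ^ p - x| ≤ L * |x - 1| := by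
    intro x hx
    have := (convex_Ioc (0 : ℝ) M).norm_image_sub_le_of_norm_hasDerivWithin_le
      (f := fun x => x ^ p - x) (f' := fun x => p * x ^ (p - 1) - 1) (C := L)
      (fun y hy => ((Real.hasDerivAt_rpow_const (Or.inl hy.1.ne')).sub
        (hasDerivAt_id' y)).hasDerivWithinAt)
      (fun y hy => by
        have h1 : y ^ (p - 1) ≤ M ^ (p - 1) :=
          Real.rpow_le_rpow hy.1.le hy.2 (by linarith)
        have h2 : 0 ≤ y ^ (p - 1) := Real.rpow_nonneg hy.1.le _
        rw [Real.norm_eq_abs, abs_le]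
        constructor <;> nlinarith)
      (show (1 : ℝ) ∈ Ioc 0 M from ⟨one_pos, hM⟩) hx
    simpa using this
  obtain ⟨c, hc, hc1⟩ := h.exists_eq_one hp hN hlam
  obtain ⟨x₀, hx₀, hmax⟩ := (isCompact_Icc (a := (0 : ℝ)) (b := 1)).exists_isMaxOn
    ⟨0, by norm_num⟩ (f := fun r => |U r - 1|) (h.contU.sub continuousOn_const).abs
  set d := |U x₀ - 1| with hd
  have hd0 : 0 ≤ d := abs_nonneg _
  have hmax' : ∀ r ∈ Icc (0 : ℝ) 1, |U r - 1| ≤ d := fun r hr => hmax hr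
  have hD : ∀ r ∈ Icc (0 : ℝ) 1, |D r| ≤ lam * (L * d) := by
    intro r hr
    have h1 := h.abs_deriv_le hN hlam (K := L * d) (fun x hx => (hlip _ ⟨h.pos x hx, hU x hx⟩).trans
      (mul_le_mul_of_nonneg_left (hmax' x hx) hL0.le)) hr
    refine h1.trans ?_
    have : 0 ≤ lam * (L * d) := by positivity
    nlinarith [hr.2]
  have hclose : ∀ a ∈ Icc (0 : ℝ) 1, ∀ b ∈ Icc (0 : ℝ) 1, a ≤ b →
      |U b - U a| ≤ lam * (L * d) := by
    intro a ha b hb hab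
    have hcont := h.contU.mono (Icc_subset_Icc ha.1 hb.2)
    have hder : ∀ x ∈ Ioo a b, HasDerivAt U (D x) x :=
      fun x hx => h.hasDerivAt x ⟨ha.1.trans_lt hx.1, hx.2.trans_le hb.2⟩
    have hmem : ∀ x ∈ Ioo a b, x ∈ Icc (0 : ℝ) 1 :=
      fun x hx => ⟨ha.1.trans hx.1.le, hx.2.le.trans hb.2⟩
    have h1 := sub_le_of_hasDerivAt_le hab hcont hder
      (fun x hx => (abs_le.1 (hD x (hmem x hx))).2)
    have h2 := le_sub_of_le_hasDerivAt hab hcont hder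
      (fun x hx => (abs_le.1 (hD x (hmem x hx))).1)
    have h3 : 0 ≤ lam * (L * d) := by positivity
    have h4 : b - a ≤ 1 := by linarith [ha.1, hb.2]
    rw [abs_le]
    constructor <;> nlinarith
  -- The maximal deviation `d` is the increment of `U` between `x₀` and the point `c` where `U = 1`.
  -- As `lam * L < 1`, it must vanish.
  have hdle : d ≤ lam * (L * d) := by
    rcases le_total c x₀ with h1 | h1
    · nth_rewrite 1 [hd]
      rw [← hc1]
      exact hclose c (Ioo_subset_Icc_self hc) x₀ hx₀ h1
    · nth_rewrite 1 [hd]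
      rw [← hc1, abs_sub_comm]
      exact hclose x₀ hx₀ c (Ioo_subset_Icc_self hc) h1
  have hd1 : d = 0 := by
    by_contra hne
    have : 0 < d := lt_of_le_of_ne hd0 (Ne.symm hne)
    nlinarith
  intro r hr
  have := hmax' r hr
  rw [hd1] at this
  linarith [abs_eq_zero.1 (le_antisymm this (abs_nonneg _))]

end IsRadialProfile

/-! ### Uniform bound for small `lam`. -/

/-- Monotonicity of `x ^ (p + 1) / (p + 1) - x ^ 2 / 2` beyond its positive zero. -/
lemma le_of_potential_le {p x y : ℝ} (hp : 1 < p) (hx : 0 < x) (hy : 0 < y)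
    (hxB : (p + 1) / 2 ≤ x ^ (p - 1))
    (hxy : x ^ (p + 1) / (p + 1) - x ^ 2 / 2 ≤ y ^ (p + 1) / (p + 1) - y ^ 2 / 2) : x ≤ y := by
  by_contra! hlt
  have e : ∀ z : ℝ, 0 < z → z ^ (p + 1) / (p + 1) - z ^ 2 / 2
      = z ^ 2 * (z ^ (p - 1) / (p + 1) - 1 / 2) := by
    intro z hz
    rw [show p + 1 = (p - 1) + (2 : ℕ) by push_cast; ring, Real.rpow_add_natCast hz.ne']
    ring
  rw [e x hx, e y hy] at hxy
  have h1 : y ^ (p - 1) < x ^ (p - 1) := Real.rpow_lt_rpow hy.le hlt (by linarith)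
  have h2 : y ^ (p - 1) / (p + 1) - 1 / 2 < x ^ (p - 1) / (p + 1) - 1 / 2 :=
    sub_lt_sub_right (div_lt_div_of_pos_right h1 (by linarith)) _
  have h3 : 0 ≤ x ^ (p - 1) / (p + 1) - 1 / 2 := by
    rw [sub_nonneg, le_div_iff₀ (by linarith)]
    linarith
  have h4 : y ^ 2 < x ^ 2 := by gcongr
  have h5 := mul_lt_mul_of_pos_left h2 (sq_pos_of_pos hy)
  have h6 := mul_le_mul_of_nonneg_right h4.le h3
  linarith

namespace IsRadialProfile

variable {N : ℕ} {p lam : ℝ} {U D : ℝ → ℝ}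

/-- The Pohozaev functional starts at `0` and decreases to `lam F(U 1)`, so `U 1` is at most the
positive zero of `F`. -/
lemma rpow_boundary_le (hp : 1 < p) (hN : 3 ≤ N) (hlam : 0 < lam)
    (ha : 0 ≤ ((N : ℝ) - 2) / 2 - N / (p + 1)) (h : IsRadialProfile N p lam U D) :
    U 1 ^ (p - 1) ≤ (p + 1) / 2 := by
  have h1 := h.pohozaev_antitone hp hN hlam ha le_rfl zero_le_one le_rfl
  rw [pohozaev_zero hN, h.pohozaev_one] at h1
  have hU := h.pos 1 (by norm_num)
  have h2 : U 1 ^ (p + 1) / (p + 1) - U 1 ^ 2 / 2 ≤ 0 := by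
    by_contra! hc
    nlinarith
  rw [show p + 1 = (p - 1) + (2 : ℕ) by push_cast; ring, Real.rpow_add_natCast hU.ne'] at h2
  rw [show p - 1 + ((2 : ℕ) : ℝ) = p + 1 by push_cast; ring] at h2
  have h3 : U 1 ^ 2 * (U 1 ^ (p - 1) / (p + 1) - 1 / 2) ≤ 0 := by
    calc _ = _ := by ring
      _ ≤ 0 := h2
  have h4 : U 1 ^ (p - 1) / (p + 1) - 1 / 2 ≤ 0 := by
    by_contra! hc
    have : 0 < U 1 ^ 2 := by positivity
    nlinarith
  rw [sub_nonpos, div_le_iff₀ (by linarith)] at h4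
  linarith

/-- Where it is large, a solution is bounded by its central value. -/
lemma le_center_of_large (hp : 1 < p) (hN : 3 ≤ N) (hlam : 0 < lam)
    (h : IsRadialProfile N p lam U D) {r : ℝ} (hr : r ∈ Icc (0 : ℝ) 1)
    (hUr : (p + 1) / 2 ≤ U r ^ (p - 1)) : U r ≤ U 0 := by
  refine le_of_potential_le hp (h.pos r hr) (h.pos 0 (by norm_num)) hUr ?_
  have := h.energy_le hp hN hr
  have h2 := sq_nonneg (D r)
  refine le_of_mul_le_mul_left ?_ hlam
  linarith

lemma le_center (hp : 1 < p) (hN : 3 ≤ N) (hlam : 0 < lam) (h : IsRadialProfile N p lam U D)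
    (h0 : (p + 1) / 2 ≤ U 0 ^ (p - 1)) {r : ℝ} (hr : r ∈ Icc (0 : ℝ) 1) : U r ≤ U 0 := by
  by_contra! hc
  have h1 : U 0 ^ (p - 1) ≤ U r ^ (p - 1) :=
    Real.rpow_le_rpow (h.pos 0 (by norm_num)).le hc.le (by linarith)
  exact hc.not_ge (h.le_center_of_large hp hN hlam hr (h0.trans h1))

/-- Near the origin, at the scale `lam U(0) ^ (p - 1) r ^ 2 ≤ 1`, the solution stays comparable
to its central value. -/
lemma core_bounds (hp : 1 < p) (hN : 3 ≤ N) (hlam : 0 < lam) (h : IsRadialProfile N p lam U D)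
    (h0 : (p + 1) / 2 ≤ U 0 ^ (p - 1)) {r : ℝ} (hr : r ∈ Icc (0 : ℝ) 1)
    (hr1 : lam * U 0 ^ (p - 1) * r ^ 2 ≤ 1) :
    |r * D r| ≤ lam * U 0 ^ (p - 1) * r ^ 2 * U 0 ∧ U 0 / 2 ≤ U r := by
  have hm : 0 < U 0 := h.pos 0 (by norm_num)
  have hm1 : 1 ≤ U 0 := by
    by_contra! hc
    have := Real.rpow_lt_one hm.le hc (show 0 < p - 1 by linarith)
    linarith
  have hpow : U 0 ^ p = U 0 ^ (p - 1) * U 0 := by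
    rw [← Real.rpow_add_one hm.ne', sub_add_cancel]
  have hK : ∀ x ∈ Icc (0 : ℝ) 1, |U x ^ p - U x| ≤ U 0 ^ p := by
    intro x hx
    have hx0 := h.pos x hx
    have hx1 := h.le_center hp hN hlam h0 hx
    have h2 : U x ^ p ≤ U 0 ^ p := Real.rpow_le_rpow hx0.le hx1 (by linarith)
    have h3 : U 0 ≤ U 0 ^ p := Real.self_le_rpow_of_one_le hm1 hp.le
    have h4 : 0 < U x ^ p := Real.rpow_pos_of_pos hx0 _
    rw [abs_le]
    constructor <;> linarith
  have hD : ∀ x ∈ Icc (0 : ℝ) 1, |D x| ≤ lam * U 0 ^ p * x :=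
    fun x hx => h.abs_deriv_le hN hlam hK hx
  constructor
  · rw [abs_mul, abs_of_nonneg hr.1]
    calc r * |D r| ≤ r * (lam * U 0 ^ p * r) := mul_le_mul_of_nonneg_left (hD r hr) hr.1
      _ = _ := by rw [hpow]; ring
  · have h1 := sub_le_sub_of_hasDerivAt_le (a := 0) (b := r) (g := U) (g' := D)
      (f := fun x => -(lam * U 0 ^ p * x ^ 2 / 2)) (f' := fun x => -(lam * U 0 ^ p * x))
      hr.1 (by fun_prop) (h.contU.mono (Icc_subset_Icc_right hr.2))
      (fun x _ => by
        refine (((hasDerivAt_pow 2 x).const_mul (lam * U 0 ^ p)).div_const 2).fun_neg.congr_deriv ?_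
        norm_num
        ring)
      (fun x hx => h.hasDerivAt x ⟨hx.1, hx.2.trans_le hr.2⟩)
      (fun x hx => (abs_le.1 (hD x ⟨hx.1.le, hx.2.le.trans hr.2⟩)).1)
    have h2 : lam * U 0 ^ p * r ^ 2 ≤ U 0 := by
      rw [hpow]
      nlinarith
    norm_num at h1
    linarith

/-- If the central value is large, the scaled energy is quantitatively negative beyond the core. -/
lemma scaledEnergy_one_le {θ k : ℝ} (hp : 1 < p) (hN : 3 ≤ N) (hlam : 0 < lam)
    (hθ : θ * (p - 1) = 2) (hκ : 0 < (N : ℝ) - 2 - 2 * θ) (hk : 0 < k) (hk1 : k ≤ 1)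
    (hk2 : k * (2 * θ + 3) ≤ θ * ((N : ℝ) - 2 - 2 * θ) / 4) (h : IsRadialProfile N p lam U D)
    (h0 : (p + 1) / 2 ≤ U 0 ^ (p - 1)) (hk3 : k ≤ lam * U 0 ^ (p - 1)) :
    scaledEnergy N p lam θ U D 1
      ≤ -((k / lam) ^ θ * (θ * ((N : ℝ) - 2 - 2 * θ) / 16)) := by
  have hm : 0 < U 0 := h.pos 0 (by norm_num)
  have hθ0 : 0 < θ := by
    by_contra hc
    nlinarith
  have hA : 0 < lam * U 0 ^ (p - 1) := by positivity
  -- The edge of the core, where `lam U(0) ^ (p - 1) r ^ 2 = k`. There `r ^ (2θ)` is `(k / lam) ^ θ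
  -- / U(0) ^ 2`, so `U 0` drops out of the final bound.
  set r := √(k / (lam * U 0 ^ (p - 1))) with hrdef
  have hr0 : 0 < r := Real.sqrt_pos.2 (by positivity)
  have hrsq : r ^ 2 = k / (lam * U 0 ^ (p - 1)) := Real.sq_sqrt (by positivity)
  have hr1 : r ≤ 1 := by
    rw [hrdef, Real.sqrt_le_iff]
    exact ⟨zero_le_one, by rw [one_pow]; exact (div_le_one hA).2 hk3⟩
  have hrk : lam * U 0 ^ (p - 1) * r ^ 2 = k := by
    rw [hrsq]
    field_simp
  have hr : r ∈ Icc (0 : ℝ) 1 := ⟨hr0.le, hr1⟩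
  obtain ⟨hD, hU2⟩ := h.core_bounds hp hN hlam h0 hr (hrk.le.trans hk1)
  rw [hrk] at hD
  have hUr := h.pos r hr
  have hUle := h.le_center hp hN hlam h0 hr
  refine (h.scaledEnergy_antitone hp hlam hθ hκ.le hr0 hr1 le_rfl).trans ?_
  have hpw : r ^ (2 * θ) = (k / lam) ^ θ / U 0 ^ 2 := by
    rw [Real.rpow_mul hr0.le, Real.rpow_two, hrsq, ← div_div,
      Real.div_rpow (by positivity) (by positivity), ← Real.rpow_mul hm.le, mul_comm (p - 1), hθ,
      Real.rpow_two]
  have hz : lam * r ^ 2 * U r ^ (p + 1) ≤ k * U r ^ 2 := by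
    rw [show p + 1 = (p - 1) + (2 : ℕ) by push_cast; ring, Real.rpow_add_natCast hUr.ne']
    have h1 : U r ^ (p - 1) ≤ U 0 ^ (p - 1) := Real.rpow_le_rpow hUr.le hUle (by linarith)
    calc lam * r ^ 2 * (U r ^ (p - 1) * U r ^ 2)
        = lam * U r ^ (p - 1) * r ^ 2 * U r ^ 2 := by ring
      _ ≤ lam * U 0 ^ (p - 1) * r ^ 2 * U r ^ 2 := by gcongr
      _ = _ := by rw [hrk]
  have hz' : lam * r ^ 2 * U r ^ (p + 1) / (p + 1) ≤ k * U r ^ 2 :=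
    (div_le_self (by positivity) (by linarith)).trans hz
  have hx : |r * D r| ≤ 2 * k * U r := hD.trans (by nlinarith)
  have hsq : (θ * U r + r * D r) ^ 2 ≤ ((θ + 2 * k) * U r) ^ 2 := by
    rw [abs_le] at hx
    refine sq_le_sq.2 (abs_le_abs ?_ ?_)
    · linarith [hx.2]
    · nlinarith [hx.1, mul_pos hθ0 hUr]
  have hbr : (θ * U r + r * D r) ^ 2 / 2 - θ * ((N : ℝ) - 2 - θ) * U r ^ 2 / 2
      + lam * r ^ 2 * U r ^ (p + 1) / (p + 1) - lam * r ^ 2 * U r ^ 2 / 2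
      ≤ -(θ * ((N : ℝ) - 2 - 2 * θ) / 4) * U r ^ 2 := by
    have h1 : 0 ≤ lam * r ^ 2 * U r ^ 2 / 2 := by positivity
    -- Expanding gives `-θ (N - 2 - 2θ) / 2` plus this error in `k`; `hk2` lets the error absorb at
    -- most half of the main term.
    have h2 : (2 * k * θ + 2 * k ^ 2 + k) ≤ θ * ((N : ℝ) - 2 - 2 * θ) / 4 := by nlinarith
    have h3 := mul_le_mul_of_nonneg_right h2 (sq_nonneg (U r))
    nlinarith
  have hU4 : U 0 ^ 2 / 4 ≤ U r ^ 2 := by nlinarith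
  have hpos : 0 < θ * ((N : ℝ) - 2 - 2 * θ) := mul_pos hθ0 hκ
  unfold scaledEnergy
  calc _ ≤ r ^ (2 * θ) * (-(θ * ((N : ℝ) - 2 - 2 * θ) / 4) * U r ^ 2) := by gcongr
    _ ≤ r ^ (2 * θ) * (-(θ * ((N : ℝ) - 2 - 2 * θ) / 4) * (U 0 ^ 2 / 4)) := by
      refine mul_le_mul_of_nonneg_left ?_ (by positivity)
      exact mul_le_mul_of_nonpos_left hU4 (by linarith)
    _ = _ := by
      rw [hpw]
      field_simp
      ring

lemma scaledEnergy_one_ge {θ : ℝ} (hp : 1 < p) (hlam : 0 < lam) (h : IsRadialProfile N p lam U D) :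
    -((θ * ((N : ℝ) - 2 - θ) + lam) / 2 * U 1 ^ 2) ≤ scaledEnergy N p lam θ U D 1 := by
  have hU := h.pos 1 (by norm_num)
  have h1 : 0 ≤ lam * U 1 ^ (p + 1) / (p + 1) := by positivity
  simp only [scaledEnergy, Real.one_rpow, h.one, one_pow, mul_one, one_mul, add_zero]
  nlinarith [sq_nonneg (θ * U 1)]

end IsRadialProfile

/-- A priori bound: in the supercritical range the solutions are bounded uniformly for
small `lam`. -/
lemma exists_uniform_bound {N : ℕ} {p : ℝ} (hp : 1 < p) (hN : 3 ≤ N)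
    (ha : 0 ≤ ((N : ℝ) - 2) / 2 - N / (p + 1)) (hκ : 0 < (N : ℝ) - 2 - 2 * (2 / (p - 1))) :
    ∃ M lam₀ : ℝ, 1 ≤ M ∧ 0 < lam₀ ∧ ∀ lam, 0 < lam → lam < lam₀ → ∀ U D : ℝ → ℝ,
      IsRadialProfile N p lam U D → ∀ r ∈ Icc (0 : ℝ) 1, U r ≤ M := by
  have hp1 : 0 < p - 1 := by linarith
  set θ := 2 / (p - 1) with hθdef
  have hθ0 : 0 < θ := by positivity
  have hθ : θ * (p - 1) = 2 := by rw [hθdef]; field_simp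
  set κ := (N : ℝ) - 2 - 2 * θ with hκdef
  set B := ((p + 1) / 2) ^ (p - 1)⁻¹ with hB
  have hB1 : 1 ≤ B := Real.one_le_rpow (by linarith) (by positivity)
  have hBp : B ^ (p - 1) = (p + 1) / 2 := Real.rpow_inv_rpow (by linarith) hp1.ne'
  set k := min 1 (θ * κ / 4 / (2 * θ + 3)) with hkdef
  have hk : 0 < k := by positivity
  have hk1 : k ≤ 1 := min_le_left _ _
  have hk2 : k * (2 * θ + 3) ≤ θ * κ / 4 := by
    rw [← le_div_iff₀ (by positivity)]
    exact min_le_right _ _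
  set C := (θ * ((N : ℝ) - 2 - θ) + 1) / 2 * B ^ 2 with hC
  have hC0 : 0 < C := by
    have : 0 < (N : ℝ) - 2 - θ := by linarith
    positivity
  -- For such `lam`, the upper bound for the scaled energy at `1` falls below its lower bound `-C`.
  have hev : ∀ᶠ lam in 𝓝[>] (0 : ℝ), C < (k / lam) ^ θ * (θ * κ / 16) := by
    have h1 : Tendsto (fun lam : ℝ => k / lam) (𝓝[>] 0) atTop :=
      (tendsto_inv_nhdsGT_zero.const_mul_atTop hk).congr (fun x => by rw [div_eq_mul_inv])
    have h2 := ((tendsto_rpow_atTop hθ0).comp h1).atTop_mul_const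
      (show 0 < θ * κ / 16 by positivity)
    exact h2.eventually (eventually_gt_atTop C)
  obtain ⟨ε, hε, he⟩ := (nhdsGT_basis (0 : ℝ)).eventually_iff.1 hev
  refine ⟨2 * B, min ε 1, by linarith, lt_min hε one_pos, ?_⟩
  intro lam hlam hlt U D h r hr
  have hU1p := h.rpow_boundary_le hp hN hlam ha
  have hU1pos := h.pos 1 (by norm_num)
  have hU1 : U 1 ≤ B := by
    by_contra! hc
    have := Real.rpow_lt_rpow (by linarith) hc hp1
    linarith
  rcases le_or_gt (U 0) (2 * B) with hm | hm
  · by_contra! hc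
    have h1 : (p + 1) / 2 ≤ U r ^ (p - 1) := by
      rw [← hBp]
      exact Real.rpow_le_rpow (by linarith) (by linarith) hp1.le
    linarith [h.le_center_of_large hp hN hlam hr h1]
  · exfalso
    have h0 : (p + 1) / 2 ≤ U 0 ^ (p - 1) := by
      rw [← hBp]
      exact Real.rpow_le_rpow (by linarith) (by linarith) hp1.le
    -- The core edge lies inside the ball in the first case; in the second the core covers the ball,
    -- so `U 1 ≥ U 0 / 2 > B`.
    rcases le_or_gt k (lam * U 0 ^ (p - 1)) with hk3 | hk3
    · have h1 := h.scaledEnergy_one_le hp hN hlam hθ hκ hk hk1 hk2 h0 hk3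
      have h2 := h.scaledEnergy_one_ge (θ := θ) hp hlam
      have h3 := he (show lam ∈ Ioo 0 ε from ⟨hlam, hlt.trans_le (min_le_left _ _)⟩)
      have hl1 : lam ≤ 1 := hlt.le.trans (min_le_right _ _)
      have h4 : (θ * ((N : ℝ) - 2 - θ) + lam) / 2 * U 1 ^ 2 ≤ C := by
        have : 0 < (N : ℝ) - 2 - θ := by linarith
        rw [hC]
        gcongr
      linarith
    · have := (h.core_bounds hp hN hlam h0 (r := 1) (by norm_num) (by linarith)).2
      linarith

/-! ### Decreasing solutions for large `lam`. -/

/-- For `x ≥ 1` the nonlinearity dominates `(p - 1) (x - 1)`. -/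
lemma mul_sub_one_le_rpow_sub {p x : ℝ} (hp : 1 < p) (hx : 1 ≤ x) :
    (p - 1) * (x - 1) ≤ x ^ p - x := by
  have := one_add_mul_self_le_rpow_one_add (s := x - 1) (by linarith) hp.le
  rw [show 1 + (x - 1) = x by ring] at this
  linarith

/-- For `δ ≤ x ≤ 1` the absorption dominates `δ c (1 - x)`, with `c = min 1 (p - 1)`. -/
lemma mul_one_sub_le_sub_rpow {p x δ : ℝ} (hp : 1 < p) (hδ : 0 < δ) (hx : δ ≤ x) (hx1 : x ≤ 1) :
    δ * min 1 (p - 1) * (1 - x) ≤ x - x ^ p := by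
  set c := min 1 (p - 1) with hc
  have hc0 : 0 < c := lt_min one_pos (by linarith)
  have hc1 : c ≤ 1 := min_le_left _ _
  have hcp : c ≤ p - 1 := min_le_right _ _
  have hx0 : 0 < x := hδ.trans_le hx
  have h1 : x ^ (p - 1) ≤ x ^ c := Real.rpow_le_rpow_of_exponent_ge hx0 hx1 hcp
  have h2 : x ^ c ≤ 1 + c * (x - 1) := by
    have := rpow_one_add_le_one_add_mul_self (s := x - 1) (by linarith) hc0.le hc1
    rwa [show 1 + (x - 1) = x by ring] at this
  have h3 : x ^ p = x ^ (p - 1) * x := by rw [← Real.rpow_add_one hx0.ne', sub_add_cancel]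
  have h4 : c * (1 - x) ≤ 1 - x ^ (p - 1) := by linarith
  have h5 : 0 ≤ c * (1 - x) := mul_nonneg hc0.le (by linarith)
  rw [h3]
  calc δ * c * (1 - x) = δ * (c * (1 - x)) := by ring
    _ ≤ x * (1 - x ^ (p - 1)) := mul_le_mul hx h4 h5 hx0.le
    _ = _ := by ring

namespace IsRadialProfile

variable {N : ℕ} {p lam : ℝ} {U D : ℝ → ℝ}

lemma deriv_nonpos (h : IsRadialProfile N p lam U D) (hU : StrictAntiOn U (Icc 0 1)) {r : ℝ}
    (hr : r ∈ Ioo (0 : ℝ) 1) : D r ≤ 0 := by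
  have h1 := hU.antitoneOn.derivWithin_nonpos (x := r)
  rwa [derivWithin_of_mem_nhds (Icc_mem_nhds hr.1 hr.2), (h.hasDerivAt r hr).deriv] at h1

/-- A decreasing solution which is still above `1` at `b` forces `lam` to be bounded. -/
lemma bound_of_one_lt {a b : ℝ} (hp : 1 < p) (hN : 3 ≤ N) (hlam : 0 < lam)
    (h : IsRadialProfile N p lam U D) (hU : StrictAntiOn U (Icc 0 1)) (ha : 0 < a) (hab : a < b)
    (hb : b < 1) (hUb : 1 < U b) :
    lam * ((p - 1) * (a / 2) ^ (N - 1) * (a / 2) * (b - a)) ≤ 1 := by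
  have hgt : ∀ x ∈ Icc 0 b, 1 < U x := fun x hx => hUb.trans_le
    (hU.antitoneOn ⟨hx.1, hx.2.trans hb.le⟩ ⟨by linarith, hb.le⟩ hx.2)
  have haI : a ∈ Icc (0 : ℝ) 1 := ⟨ha.le, by linarith⟩
  have hflux : ∀ r s, 0 < r → r ≤ s → s ≤ b → ∀ C, (∀ x ∈ Ioo r s,
      -(lam * x ^ (N - 1) * (U x ^ p - U x)) ≤ C) →
      s ^ (N - 1) * D s - r ^ (N - 1) * D r ≤ C * (s - r) := fun r s hr hrs hs C hC =>
    sub_le_of_hasDerivAt_le hrs (h.continuousOn_flux.mono (Icc_subset_Icc hr.le (by linarith)))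
      (fun x hx => h.hasDerivAt_flux hN ⟨hr.trans hx.1, by linarith [hx.2]⟩) hC
  set w := U a - 1 with hw
  have hw0 : 0 < w := by linarith [hgt a ⟨ha.le, hab.le⟩]
  set A := lam * (a / 2) ^ (N - 1) * ((p - 1) * w) with hA
  have hA0 : 0 < A := by
    have : 0 < p - 1 := by linarith
    positivity
  -- The flux drops by at least `A * (a / 2)` on `[a / 2, a]` and cannot recover on `[a, b]`. So `U`
  -- falls by a multiple of `w` there, yet by less than `w` because `U b > 1`.
  have h1 := hflux (a / 2) a (by linarith) (by linarith) hab.le (-A) (fun x hx => by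
    have hx1 : U a ≤ U x := hU.antitoneOn ⟨by linarith [hx.1], by linarith [hx.2]⟩ haI hx.2.le
    have h2 := mul_sub_one_le_rpow_sub hp (hgt x ⟨by linarith [hx.1], by linarith [hx.2]⟩).le
    have h3 : (p - 1) * w ≤ U x ^ p - U x :=
      (mul_le_mul_of_nonneg_left (by linarith) (by linarith)).trans h2
    have h4 : 0 ≤ (p - 1) * w := mul_nonneg (by linarith) hw0.le
    have h5 : (a / 2) ^ (N - 1) ≤ x ^ (N - 1) := pow_le_pow_left₀ (by linarith) hx.1.le _
    have hx0 : 0 < x := by linarith [hx.1]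
    rw [hA, neg_le_neg_iff]
    gcongr)
  have hDa2 := h.deriv_nonpos hU (r := a / 2) ⟨by linarith, by linarith⟩
  have h2 : a ^ (N - 1) * D a ≤ -A * (a / 2) := by
    have : (a / 2) ^ (N - 1) * D (a / 2) ≤ 0 := mul_nonpos_of_nonneg_of_nonpos (by positivity) hDa2
    nlinarith
  have hD : ∀ x ∈ Ioo a b, D x ≤ -A * (a / 2) := by
    intro x hx
    have hx0 : 0 < x := ha.trans hx.1
    have h3 := hflux a x ha hx.1.le hx.2.le 0 (fun y hy => by
      have h4 := mul_sub_one_le_rpow_sub hp (hgt y ⟨by linarith [hy.1], by linarith [hy.2, hx.2]⟩).le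
      have h5 : 0 ≤ (p - 1) * (U y - 1) := mul_nonneg (by linarith)
        (by linarith [hgt y ⟨by linarith [hy.1], by linarith [hy.2, hx.2]⟩])
      have hy0 : 0 < y := ha.trans hy.1
      have : 0 ≤ lam * y ^ (N - 1) * (U y ^ p - U y) := mul_nonneg (by positivity) (h5.trans h4)
      linarith)
    have h6 : x ^ (N - 1) ≤ 1 := pow_le_one₀ hx0.le (by linarith [hx.2])
    have h7 := h.deriv_nonpos hU (r := x) ⟨hx0, by linarith [hx.2]⟩
    nlinarith
  have h8 := sub_le_of_hasDerivAt_le hab.le (h.contU.mono (Icc_subset_Icc ha.le hb.le))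
    (fun x hx => h.hasDerivAt x ⟨ha.trans hx.1, hx.2.trans hb⟩) hD
  have h9 : A * (a / 2) * (b - a) ≤ w := by linarith
  rw [← mul_le_mul_iff_left₀ hw0]
  calc _ = A * (a / 2) * (b - a) := by rw [hA]; ring
    _ ≤ _ := by linarith

/-- A decreasing solution with values in `[δ, 1]` on `[a, b]` forces `lam` to be bounded. -/
lemma bound_of_le_one {a c b δ : ℝ} (hp : 1 < p) (hN : 3 ≤ N) (hlam : 0 < lam)
    (h : IsRadialProfile N p lam U D) (hU : StrictAntiOn U (Icc 0 1)) (ha : 0 < a) (hac : a < c)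
    (hcb : c < b) (hb : b < 1) (hUa : U a ≤ 1) (hδ : 0 < δ) (hUb : δ ≤ U b) :
    lam * (δ * min 1 (p - 1) * a ^ (N - 1) * (b - c) * (c - a)) ≤ 1 := by
  set γ := δ * min 1 (p - 1) with hγ
  have hγ0 : 0 < γ := mul_pos hδ (lt_min one_pos (by linarith))
  have hle : ∀ x ∈ Icc a b, U x ≤ 1 ∧ δ ≤ U x := fun x hx =>
    ⟨(hU.antitoneOn ⟨ha.le, by linarith⟩ ⟨ha.le.trans hx.1, by linarith [hx.2]⟩ hx.1).trans hUa,
      hUb.trans (hU.antitoneOn ⟨ha.le.trans hx.1, by linarith [hx.2]⟩ ⟨by linarith, hb.le⟩ hx.2)⟩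
  have hf : ∀ x ∈ Icc a b, γ * (1 - U x) ≤ U x - U x ^ p := fun x hx =>
    mul_one_sub_le_sub_rpow hp hδ (hle x hx).2 (hle x hx).1
  have hflux : ∀ r s, a ≤ r → r ≤ s → s ≤ b → ∀ C, (∀ x ∈ Ioo r s,
      C ≤ -(lam * x ^ (N - 1) * (U x ^ p - U x))) →
      C * (s - r) ≤ s ^ (N - 1) * D s - r ^ (N - 1) * D r := fun r s hr hrs hs C hC =>
    le_sub_of_le_hasDerivAt hrs (h.continuousOn_flux.mono
      (Icc_subset_Icc (by linarith) (by linarith)))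
      (fun x hx => h.hasDerivAt_flux hN ⟨by linarith [hx.1], by linarith [hx.2]⟩) hC
  have hc : c ∈ Icc (0 : ℝ) 1 := ⟨by linarith, by linarith⟩
  set y := 1 - U c with hy
  have hy0 : 0 < y := by linarith [hU (show a ∈ Icc (0 : ℝ) 1 from ⟨ha.le, by linarith⟩) hc hac]
  set A := lam * a ^ (N - 1) * (γ * y) with hA
  have hA0 : 0 < A := by positivity
  -- Below `1` the flux increases instead. Being nonpositive at `b`, it is at most `-A * (b - c)` at
  -- `c` and at every earlier point of `[a, c]`, while `U` can fall by at most `y` on `[a, c]`.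
  have h1 := hflux c b hac.le hcb.le le_rfl A (fun x hx => by
    have hx1 : U x ≤ U c := hU.antitoneOn hc ⟨by linarith [hx.1], by linarith [hx.2]⟩ hx.1.le
    have h3 : γ * y ≤ U x - U x ^ p := (mul_le_mul_of_nonneg_left (by linarith) hγ0.le).trans
      (hf x ⟨by linarith [hx.1], hx.2.le⟩)
    have h5 : a ^ (N - 1) ≤ x ^ (N - 1) := pow_le_pow_left₀ ha.le (by linarith [hx.1]) _
    have hx0 : 0 < x := by linarith [hx.1]
    calc A ≤ lam * x ^ (N - 1) * (U x - U x ^ p) := by rw [hA]; gcongr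
      _ = _ := by ring)
  have hDb : b ^ (N - 1) * D b ≤ 0 := mul_nonpos_of_nonneg_of_nonpos
    (pow_nonneg (by linarith) _) (h.deriv_nonpos hU ⟨by linarith, hb⟩)
  have hD : ∀ x ∈ Ioo a c, D x ≤ -A * (b - c) := by
    intro x hx
    have hx0 : 0 < x := ha.trans hx.1
    have h3 := hflux x c hx.1.le hx.2.le hcb.le 0 (fun z hz => by
      have hz' : z ∈ Icc a b := ⟨by linarith [hz.1, hx.1], by linarith [hz.2]⟩
      have h5 : 0 ≤ γ * (1 - U z) := mul_nonneg hγ0.le (by linarith [(hle z hz').1])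
      have hz0 : 0 < z := hx0.trans hz.1
      have : 0 ≤ lam * z ^ (N - 1) * (U z - U z ^ p) :=
        mul_nonneg (by positivity) (h5.trans (hf z hz'))
      linarith)
    have h6 : x ^ (N - 1) ≤ 1 := pow_le_one₀ hx0.le (by linarith [hx.2])
    have h7 := h.deriv_nonpos hU (r := x) ⟨hx0, by linarith [hx.2]⟩
    nlinarith
  have h8 := sub_le_of_hasDerivAt_le hac.le (h.contU.mono (Icc_subset_Icc ha.le hc.2))
    (fun x hx => h.hasDerivAt x ⟨ha.trans hx.1, by linarith [hx.2]⟩) hD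
  have h9 : A * (b - c) * (c - a) ≤ y := by linarith
  rw [← mul_le_mul_iff_left₀ hy0]
  calc _ = A * (b - c) * (c - a) := by rw [hA]; ring
    _ ≤ _ := by linarith

/-- A decreasing solution which is small on `[1 / 4, 1]` forces `lam` to be bounded. -/
lemma bound_of_small (hp : 1 < p) (hN : 3 ≤ N) (hlam : 0 < lam)
    (ha : 0 ≤ ((N : ℝ) - 2) / 2 - N / (p + 1)) (h : IsRadialProfile N p lam U D)
    (hU : StrictAntiOn U (Icc 0 1)) (hsmall : U (1 / 4) ^ (p - 1) ≤ 1 / 2) :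
    (1 / 4 : ℝ) ^ (N - 1) * (lam / 32) ^ 2 ≤ 2 := by
  have hN' : (3 : ℝ) ≤ N := by exact_mod_cast hN
  have h1pos := h.pos 1 (by norm_num)
  have hD2 : ∀ x ∈ Ioo (1 / 4 : ℝ) 1,
      lam * U 1 / 2 ≤ -(((N : ℝ) - 1) / x * D x) - lam * (U x ^ p - U x) := by
    intro x hx
    have hx0 : 0 < x := by linarith [hx.1]
    have hxI : x ∈ Icc (0 : ℝ) 1 := ⟨hx0.le, hx.2.le⟩
    have hUx := h.pos x hxI
    have h1 : 0 ≤ -(((N : ℝ) - 1) / x * D x) := by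
      rw [neg_nonneg]
      exact mul_nonpos_of_nonneg_of_nonpos (div_nonneg (by linarith) hx0.le)
        (h.deriv_nonpos hU ⟨hx0, hx.2⟩)
    have h2 : U x ≤ U (1 / 4) := hU.antitoneOn (by norm_num) hxI hx.1.le
    have h3 : U x ^ (p - 1) ≤ 1 / 2 :=
      (Real.rpow_le_rpow hUx.le h2 (by linarith)).trans hsmall
    have h4 : U x ^ p = U x ^ (p - 1) * U x := by
      rw [← Real.rpow_add_one hUx.ne', sub_add_cancel]
    have h5 : U 1 ≤ U x := hU.antitoneOn hxI (by norm_num) hx.2.le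
    have h6 : U 1 / 2 ≤ U x - U x ^ p := by rw [h4]; nlinarith
    nlinarith
  -- Integrates the convexity bound `hD2` back from `D 1 = 0` over a length of at least `1 / 4`.
  have hD : ∀ x ∈ Ioo (1 / 2 : ℝ) (3 / 4), D x ≤ -(lam * U 1 / 8) := by
    intro x hx
    have h1 := le_sub_of_le_hasDerivAt (a := x) (b := 1) (by linarith [hx.2])
      (h.contD.mono (Icc_subset_Icc_left (by linarith [hx.1])))
      (fun y hy => h.hasDerivAt' y ⟨by linarith [hx.1, hy.1], hy.2⟩)
      (fun y hy => hD2 y ⟨by linarith [hx.1, hy.1], hy.2⟩)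
    rw [h.one] at h1
    have h2 : 0 < lam * U 1 := by positivity
    nlinarith [hx.2]
  have hhalf : lam * U 1 / 32 ≤ U (1 / 2) := by
    have h1 := sub_le_of_hasDerivAt_le (a := 1 / 2) (b := 3 / 4) (by norm_num)
      (h.contU.mono (Icc_subset_Icc (by norm_num) (by norm_num)))
      (fun x hx => h.hasDerivAt x ⟨by linarith [hx.1], by linarith [hx.2]⟩) hD
    have h2 := h.pos (3 / 4) (by norm_num)
    linarith
  have hP := sub_le_of_hasDerivAt_le (a := 1 / 4) (b := 1 / 2)
    (C := -(lam * (1 / 4) ^ (N - 1) * (lam * U 1 / 32) ^ 2)) (by norm_num)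
    ((h.continuousOn_pohozaev hp).mono (Icc_subset_Icc (by norm_num) (by norm_num)))
    (fun x hx => h.hasDerivAt_pohozaev hp hN ⟨by linarith [hx.1], by linarith [hx.2]⟩)
    (fun x hx => by
      have hx0 : 0 < x := by linarith [hx.1]
      have hxI : x ∈ Ioo (0 : ℝ) 1 := ⟨hx0, by linarith [hx.2]⟩
      refine (h.pohozaev_deriv_le hlam ha hxI).trans ?_
      have h1 : U (1 / 2) ≤ U x :=
        hU.antitoneOn (Ioo_subset_Icc_self hxI) (by norm_num) hx.2.le
      have h2 : (1 / 4 : ℝ) ^ (N - 1) ≤ x ^ (N - 1) := pow_le_pow_left₀ (by norm_num) hx.1.le _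
      have h3 : lam * U 1 / 32 ≤ U x := hhalf.trans h1
      rw [neg_le_neg_iff]
      gcongr)
  -- The functional is at most `0` at `1 / 4` and at least `-lam U(1) ^ 2 / 2` at `1 / 2`, which
  -- limits its loss in between; dividing by `lam U(1) ^ 2` removes `U`.
  have hP1 := h.pohozaev_antitone hp hN hlam ha (r := 1 / 2) (by norm_num) (by norm_num) le_rfl
  have hP0 := h.pohozaev_antitone hp hN hlam ha (s := 1 / 4) le_rfl (by norm_num) (by norm_num)
  rw [pohozaev_zero hN] at hP0
  rw [h.pohozaev_one] at hP1
  have h1 : 0 ≤ lam * (U 1 ^ (p + 1) / (p + 1)) := by positivity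
  have hq : 0 < lam * U 1 ^ 2 := by positivity
  rw [← mul_le_mul_iff_left₀ hq]
  linarith

end IsRadialProfile

/-! ### Conclusion. -/

theorem mainTheorem4 (N : ℕ) (hN : 3 ≤ N) (p : ℝ) (hp : sobolevExponent N < p) :
    (∃ lamLower : ℝ, 0 < lamLower ∧
      ∀ lam : ℝ, 0 < lam → lam < lamLower →
        ¬ ∃ U : ℝ → ℝ, IsNeumannSolution N p lam U ∧
          ¬ ∃ c : ℝ, ∀ r ∈ Set.Icc (0 : ℝ) 1, U r = c) ∧
    (∃ lamUpper : ℝ, 0 < lamUpper ∧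
      ∀ lam : ℝ, lamUpper < lam →
        ¬ ∃ U : ℝ → ℝ, IsNeumannSolution N p lam U ∧
          StrictAntiOn U (Set.Icc (0 : ℝ) 1)) := by
  have hN' : (3 : ℝ) ≤ N := by exact_mod_cast hN
  have hp' : (N : ℝ) + 2 < p * ((N : ℝ) - 2) := by
    rwa [sobolevExponent, div_lt_iff₀ (by linarith)] at hp
  have hp1 : 1 < p := by
    by_contra! hc
    nlinarith
  have hp10 : 0 < p - 1 := by linarith
  have ha : 0 ≤ ((N : ℝ) - 2) / 2 - N / (p + 1) := by
    rw [sub_nonneg, div_le_div_iff₀ (by linarith) two_pos]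
    linarith
  have hκ : 0 < (N : ℝ) - 2 - 2 * (2 / (p - 1)) := by
    rw [sub_pos, ← mul_div_assoc, div_lt_iff₀ hp10]
    linarith
  constructor
  · obtain ⟨M, lam₀, hM, hlam₀, hbound⟩ := exists_uniform_bound hp1 hN ha hκ
    have hL : 0 < p * M ^ (p - 1) + 1 := by positivity
    refine ⟨min lam₀ (p * M ^ (p - 1) + 1)⁻¹, by positivity, ?_⟩
    rintro lam hlam hlt ⟨U, hU, hne⟩
    obtain ⟨D, hD⟩ := hU.exists_isRadialProfile hp1 hN
    refine hne ⟨1, hD.eq_one_of_le hp1 hN hlam hM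
      (hbound lam hlam (hlt.trans_le (min_le_left _ _)) U D hD) ?_⟩
    rw [← lt_div_iff₀ hL, one_div]
    exact hlt.trans_le (min_le_right _ _)
  · set δ := (1 / 2 : ℝ) ^ (p - 1)⁻¹ with hδ
    have hδ0 : 0 < δ := by positivity
    have hδp : δ ^ (p - 1) = 1 / 2 := Real.rpow_inv_rpow (by norm_num) hp10.ne'
    -- `c₁` and `c₂` are the coefficients of `lam` in `bound_of_one_lt` with `a = 1/16`, `b = 1/8`,
    -- and in `bound_of_le_one` with `a = 1/8`, `c = 3/16`, `b = 1/4`.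
    set c₁ := (p - 1) * (1 / 16 / 2 : ℝ) ^ (N - 1) * (1 / 16 / 2) * (1 / 8 - 1 / 16) with hc₁
    have hc₁0 : 0 < c₁ := mul_pos (by positivity) (by norm_num)
    set c₂ := δ * min 1 (p - 1) * (1 / 8 : ℝ) ^ (N - 1) * (1 / 4 - 3 / 16) * (3 / 16 - 1 / 8)
      with hc₂
    have hc₂0 : 0 < c₂ := mul_pos (mul_pos (by positivity) (by norm_num)) (by norm_num)
    set c₃ := (1 / 4 : ℝ) ^ (N - 1) with hc₃
    have hc₃0 : 0 < c₃ := by positivity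
    have hev : ∀ᶠ lam : ℝ in atTop, 1 < lam * c₁ ∧ 1 < lam * c₂ ∧ 2 < c₃ * (lam / 32) ^ 2 := by
      refine ((tendsto_id.atTop_mul_const hc₁0).eventually_gt_atTop 1).and
        (((tendsto_id.atTop_mul_const hc₂0).eventually_gt_atTop 1).and
          (Tendsto.eventually_gt_atTop (Tendsto.const_mul_atTop hc₃0 ?_) 2))
      exact (tendsto_pow_atTop two_ne_zero).comp (tendsto_id.atTop_div_const (by norm_num))
    obtain ⟨lam₁, hlam₁⟩ := eventually_atTop.1 hev
    refine ⟨max lam₁ 1, by positivity, ?_⟩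
    rintro lam hlt ⟨U, hU, hanti⟩
    obtain ⟨D, hD⟩ := hU.exists_isRadialProfile hp1 hN
    have hlam : 0 < lam := by linarith [le_max_right lam₁ 1]
    obtain ⟨h1, h2, h3⟩ := hlam₁ lam ((le_max_left _ _).trans hlt.le)
    rcases lt_or_ge 1 (U (1 / 8)) with h8 | h8
    · exact h1.not_ge (hD.bound_of_one_lt hp1 hN hlam hanti (by norm_num) (by norm_num)
        (by norm_num) h8)
    rcases le_or_gt δ (U (1 / 4)) with h4 | h4
    · exact h2.not_ge (hD.bound_of_le_one hp1 hN hlam hanti (by norm_num) (by norm_num)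
        (by norm_num) (by norm_num) h8 hδ0 h4)
    · refine h3.not_ge (hD.bound_of_small hp1 hN hlam ha hanti ?_)
      rw [← hδp]
      exact Real.rpow_le_rpow (hD.pos _ (by norm_num)).le h4.le hp10.le
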